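/- Let $n \ge 1$, let $\mathbb{R}^{2n}$ have coordinates $(x_1, y_1, \dots, x_n, y_n)$, and let $\omega_0 = dx_1 \wedge dy_1 + \dots + dx_n \wedge dy_n$ be the standard symplectic form. Let $L_1 = \{(0, \dots, 0, s, 0) \in \mathbb{R}^{2n} : s \ge 0\}$, that is, the ray on which $x_n = s \ge 0$ and all other coordinates vanish, and let $M_1 = \mathbb{R}^{2n} \setminus L_1$. Then $M_1$ is standard, i.e. $M_1$ is open and $(M_1, \omega_0|_{M_1})$ is symplectomorphic to $(\mathbb{R}^{2n}, \omega_0)$ by a smooth ($C^\infty$) symplectomorphism. Moreover, for every $\varepsilon > 0$ there is a smooth symplectomorphism $\varphi \colon (M_1, \omega_0|_{M_1}) \to (\mathbb{R}^{2n}, \omega_0)$ such that $\varphi(p) = p$ for every $p \in M_1$ outside of $\mathbb{B}^{2n-2}(\varepsilon) \times W(\varepsilon) \subset \mathbb{R}^{2n-2} \times \mathbb{R}^2 = \mathbb{R}^{2n}$, where $\mathbb{B}^{d}(\varepsilon)$ is the open Euclidean ball of radius $\varepsilon$ centered at the origin of $\mathbb{R}^{d}$ and $$W(\varepsilon) = \mathbb{B}^{2}(\varepsilon)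 \cup \Big\{(x, y) \in \mathbb{R}^2 : x > \tfrac{\sqrt{2}\,\varepsilon}{2},\ x|y| < \tfrac{\varepsilon^2}{2}\Big\}.$$ -/

import Mathlib

open scoped ContDiff

/-- The Euclidean space `ℝ²ⁿ` with coordinates `(x₁, y₁, …, xₙ, yₙ)`: the coordinate with index
`(i, 0)` is `xᵢ` and the coordinate with index `(i, 1)` is `yᵢ`. -/
abbrev PhaseSpace (n : ℕ) : Type := EuclideanSpace ℝ (Fin n × Fin 2)

/-- The standard symplectic form `ω₀ = dx₁ ∧ dy₁ + ⋯ + dxₙ ∧ dyₙ`, a constant 2-form on `ℝ²ⁿ`,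
evaluated on two tangent vectors. -/
noncomputable def omega0 {n : ℕ} (u v : PhaseSpace n) : ℝ :=
  ∑ i : Fin n, (u (i, 0) * v (i, 1) - u (i, 1) * v (i, 0))

/-- `φ` restricts to a symplectomorphism from `(A, ω₀|_A)` onto `(B, ω₀|_B)`, for open subsets
`A` and `B` of `ℝ²ⁿ`: it is a smooth bijection of `A` onto `B` with smooth inverse `ψ`, and the
pullback of `ω₀` along it is `ω₀`. Values of `φ` outside `A` play no role. -/
def IsSymplectomorphism {n : ℕ} (φ : PhaseSpace n → PhaseSpace n) (A B : Set (PhaseSpace n)) :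
    Prop :=
  IsOpen A ∧ IsOpen B ∧
  ContDiffOn ℝ ∞ φ A ∧
  (∃ ψ : PhaseSpace n → PhaseSpace n,
    Set.MapsTo φ A B ∧ Set.MapsTo ψ B A ∧ Set.InvOn ψ φ A B ∧ ContDiffOn ℝ ∞ ψ B) ∧
  ∀ x ∈ A, ∀ u v : PhaseSpace n, omega0 (fderiv ℝ φ x u) (fderiv ℝ φ x v) = omega0 u v

/-- An open subset `A` of `ℝ²ⁿ` is standard if `(A, ω₀|_A)` is symplectomorphic to `(ℝ²ⁿ, ω₀)`. -/
def IsStandard {n : ℕ} (A : Set (PhaseSpace n)) : Prop :=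
  IsOpen A ∧ ∃ φ : PhaseSpace n → PhaseSpace n, IsSymplectomorphism φ A Set.univ

/-- The parametrized ray `γ₀(s) = (0, …, 0, s, 0)` in `ℝ²ⁿ`, `n = m + 1`: the coordinate `xₙ` is
`s` and all others vanish. -/
noncomputable def gamma0 (m : ℕ) (s : ℝ) : PhaseSpace (m + 1) :=
  EuclideanSpace.single (Fin.last m, 0) s

/-- The ray `L₁`, the image of `[0, ∞)` under `γ₀`. -/
def rayL1 (m : ℕ) : Set (PhaseSpace (m + 1)) := gamma0 m '' Set.Ici 0

/-- `M₁ = ℝ²ⁿ ∖ L₁`. -/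
def spaceM1 (m : ℕ) : Set (PhaseSpace (m + 1)) := (rayL1 m)ᶜ

/-- `W(ε) = 𝔹²(ε) ∪ {(x, y) | x > √2 ε / 2, x |y| < ε² / 2}` in `ℝ²`. -/
def regionW (ε : ℝ) : Set (EuclideanSpace ℝ (Fin 2)) :=
  Metric.ball 0 ε ∪ {p | p 0 > Real.sqrt 2 * ε / 2 ∧ p 0 * |p 1| < ε ^ 2 / 2}

/-- The first `2n - 2` coordinates `(x₁, y₁, …, xₙ₋₁, yₙ₋₁)` of a point, `n = m + 1`. -/
noncomputable def initCoords {m : ℕ} (p : PhaseSpace (m + 1)) : PhaseSpace m :=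
  WithLp.toLp 2 fun k => p (k.1.castSucc, k.2)

/-- The last two coordinates `(xₙ, yₙ)` of a point, `n = m + 1`. -/
noncomputable def lastCoords {m : ℕ} (p : PhaseSpace (m + 1)) : EuclideanSpace ℝ (Fin 2) :=
  WithLp.toLp 2 fun j => p (Fin.last m, j)

/-- The neighbourhood `𝔹²ⁿ⁻²(ε) × W(ε)` of the ray in `ℝ²ⁿ⁻² × ℝ² = ℝ²ⁿ`, `n = m + 1`. -/
def rayNbhd (m : ℕ) (ε : ℝ) : Set (PhaseSpace (m + 1)) :=
  {p | initCoords p ∈ Metric.ball (0 : PhaseSpace m) ε ∧ lastCoords p ∈ regionW ε}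

/-!
For a small vector field `X`, the Cayley transform `(1 + X) ∘ (1 - X)⁻¹` is a diffeomorphism, and
it is symplectic when `X` is Hamiltonian, because `DX` is then skew for the symplectic form. It
replaces the time-one flow. With Hamiltonian `χ yₙ`, where `χ` is a bump function, `X` equals
`χ ∂/∂xₙ` on the `xₙ`-axis, so iterates of the transform push any segment of the axis forward within
a prescribed neighbourhood of it.

Compose infinitely many such pushes, the `j`-th supported close to the ray and moving the image of
the origin beyond `xₙ = j`. As the supports shrink to the ray, the composition is locally eventually
constant on the complement of the ray; as the pushes take place at larger and larger `xₙ`, so is the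
sequence of inverses on all of `ℝ²ⁿ`; and the ray itself escapes to infinity.
-/

open Set Filter Topology
open scoped NNReal

section IdAdd

variable {E : Type*} [NormedAddCommGroup E] [NormedSpace ℝ E] [CompleteSpace E]
  {X : E → E} {K : ℝ≥0}

theorem exists_homeomorph_id_add (hX : LipschitzWith K X) (hK : K < 1) :
    ∃ e : E ≃ₜ E, ∀ p, e p = p + X p := by
  have happrox : ApproximatesLinearOn (fun p => p + X p)
      (ContinuousLinearEquiv.refl ℝ E : E →L[ℝ] E) univ K := fun p _ q _ => by
    simpa [dist_eq_norm, add_sub_add_comm] using hX.dist_le_mul p q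
  refine ⟨happrox.toHomeomorph _ ?_, fun p => rfl⟩
  rcases subsingleton_or_nontrivial E with h | h
  · exact .inl h
  · simpa using .inr hK

theorem contDiff_symm_of_eq_id_add (hX : LipschitzWith K X) (hK : K < 1) {n : WithTop ℕ∞}
    (hn : n ≠ 0) (hs : ContDiff ℝ n X) (e : E ≃ₜ E) (he : ∀ p, e p = p + X p) :
    ContDiff ℝ n e.symm := by
  have hlt (p : E) : ‖-fderiv ℝ X p‖ < 1 := by
    rw [norm_neg]
    exact (norm_fderiv_le_of_lipschitz ℝ hX).trans_lt (mod_cast hK)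
  refine e.contDiff_symm
    (f₀' := fun p => ContinuousLinearEquiv.ofUnit (Units.oneSub (-fderiv ℝ X p) (hlt p)))
    (fun p => ?_) (funext he ▸ contDiff_id.add hs)
  have hderiv : HasFDerivAt e (.id ℝ E + fderiv ℝ X p) p :=
    funext he ▸ (hasFDerivAt_id p).add (hs.differentiable hn p).hasFDerivAt
  refine hderiv.congr_fderiv ?_
  ext v
  change v + fderiv ℝ X p v = v - (-fderiv ℝ X p) v
  simp

theorem exists_orderIso_id_add {f : ℝ → ℝ} (hf : LipschitzWith K f) (hK : K < 1) :
    ∃ g : ℝ ≃o ℝ, ∀ s, g s = s + f s := by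
  obtain ⟨e, he⟩ := exists_homeomorph_id_add hf hK
  have hmono : StrictMono e := fun s t hst => by
    have hlip := hf.dist_le_mul s t
    have hK' : (K : ℝ) < 1 := mod_cast hK
    rw [Real.dist_eq, dist_comm, Real.dist_eq, abs_of_pos (sub_pos.2 hst)] at hlip
    rw [he, he]
    nlinarith [le_abs_self (f s - f t)]
  exact ⟨hmono.orderIsoOfSurjective e e.surjective, he⟩

theorem exists_orderIso_eq_add_of_eq_sub {f : ℝ → ℝ} (hf : LipschitzWith K f) (hK : K < 1) :
    ∃ g : ℝ ≃o ℝ, ∀ s, ∃ u, s = u - f u ∧ g s = u + f u := by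
  obtain ⟨A, hA⟩ := exists_orderIso_id_add hf.neg hK
  obtain ⟨B, hB⟩ := exists_orderIso_id_add hf hK
  refine ⟨A.symm.trans B, fun s => ⟨A.symm s, ?_, hB _⟩⟩
  rw [sub_eq_add_neg, ← Pi.neg_apply, ← hA, A.apply_symm_apply]

end IdAdd

theorem exists_lt_iterate {α : Type*} [ConditionallyCompleteLinearOrder α] [TopologicalSpace α]
    [OrderTopology α] {g : α → α} (hg : Continuous g) {a b : α}
    (hlt : ∀ s ∈ Icc a b, s < g s) : ∃ N : ℕ, b < g^[N] a := by
  by_contra! hle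
  have hge (N : ℕ) : a ≤ g^[N] a := by
    induction N with
    | zero => rfl
    | succ N ih =>
      rw [Function.iterate_succ_apply']
      exact ih.trans (hlt _ ⟨ih, hle N⟩).le
  have hmono : Monotone fun N => g^[N] a := monotone_nat_of_le_succ fun N => by
    rw [Function.iterate_succ_apply']
    exact (hlt _ ⟨hge N, hle N⟩).le
  have hlim := tendsto_atTop_ciSup hmono ⟨b, forall_mem_range.2 hle⟩
  have hfixed := isFixedPt_of_tendsto_iterate hlim hg.continuousAt
  exact (hlt _ ⟨ge_of_tendsto' hlim hge, le_of_tendsto' hlim hle⟩).ne' hfixed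

section LocallyFinite

theorem locallyFinite_of_eventually_disjoint {X : Type*} [TopologicalSpace X] {s : ℕ → Set X}
    (h : ∀ x, ∃ t ∈ 𝓝 x, ∀ᶠ n in atTop, Disjoint (s n) t) : LocallyFinite s := fun x => by
  obtain ⟨t, ht, hst⟩ := h x
  rw [← Nat.cofinite_eq_atTop, eventually_cofinite] at hst
  exact ⟨t, ht, hst.subset fun n => not_disjoint_iff_nonempty_inter.2⟩

theorem locallyFinite_setOf_lt_of_tendsto_atTop {X α : Type*} [TopologicalSpace X] [LinearOrder α]
    [NoMaxOrder α] [TopologicalSpace α] [OrderTopology α] {f : X → α} (hf : Continuous f)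
    {a : ℕ → α} (ha : Tendsto a atTop atTop) : LocallyFinite fun n => {x | a n < f x} :=
  locallyFinite_of_eventually_disjoint fun x => by
    obtain ⟨b, hb⟩ := exists_gt (f x)
    exact ⟨{y | f y < b}, hf.continuousAt.eventually_lt_const hb,
      (ha.eventually_ge_atTop b).mono fun _ hn =>
        disjoint_left.2 fun _ hy hy' => (hn.trans_lt hy).asymm hy'⟩

theorem locallyFinite_thickening {X : Type*} [PseudoMetricSpace X] {L : Set X}
    (hL : IsClosed L) {δ : ℕ → ℝ} (hδ : Tendsto δ atTop (𝓝 0)) :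
    LocallyFinite fun n => ((↑) : ↥Lᶜ → X) ⁻¹' Metric.thickening (δ n) L := by
  refine locallyFinite_of_eventually_disjoint fun x => ?_
  obtain ⟨r, hr, hball⟩ := Metric.isOpen_iff.1 hL.isOpen_compl x x.2
  refine ⟨Metric.ball x (r / 2), Metric.ball_mem_nhds x (half_pos hr), ?_⟩
  filter_upwards [hδ.eventually_lt_const (half_pos hr)] with n hn
  refine disjoint_left.2 fun y hy hyx => ?_
  obtain ⟨z, hz, hyz⟩ := Metric.mem_thickening_iff.1 hy
  refine hball (Metric.mem_ball.2 ?_) hz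
  rw [Metric.mem_ball, Subtype.dist_eq] at hyx
  linarith [dist_triangle_left z x y]

theorem exists_eventuallyEq_of_locallyFinite {X Y : Type*} [TopologicalSpace X] {M : Set X}
    (hM : IsOpen M) {f : ℕ → X → Y} (hf : LocallyFinite fun n => {p : M | f (n + 1) p ≠ f n p}) :
    ∃ F : X → Y, ∀ p ∈ M, ∀ᶠ n in atTop, F =ᶠ[𝓝 p] f n := by
  obtain ⟨F, hF⟩ := LocallyFinite.exists_forall_eventually_atTop_eventuallyEq
    (f := fun n (p : M) => f n p) hf
  refine ⟨Function.extend (↑) F (f 0), fun p hp => (hF ⟨p, hp⟩).mono fun n hn => ?_⟩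
  rw [← hM.isOpenEmbedding_subtypeVal.map_nhds_eq ⟨p, hp⟩]
  exact eventually_map.2 (hn.mono fun q hq =>
    (Subtype.val_injective.extend_apply F (f 0) q).trans hq.symm)

/-- By `hescape` the points outside `M` have no limit in `Y`, so the limit of the inverses takes
values in `M`. -/
theorem exists_invOn_of_locallyFinite {X Y : Type*} [TopologicalSpace X] [TopologicalSpace Y]
    {M : Set X} (hM : IsOpen M) {e : ℕ → X ≃ Y}
    (he : LocallyFinite fun n => {p : M | e (n + 1) p ≠ e n p})
    (he_symm : LocallyFinite fun n => {q | (e (n + 1)).symm q ≠ (e n).symm q})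
    (hescape : ∀ p ∉ M, ∀ q, ∃ᶠ n in atTop, e n p ≠ q) :
    ∃ (φ : X → Y) (ψ : Y → X), MapsTo ψ univ M ∧ InvOn ψ φ M univ ∧
      (∀ p ∈ M, ∃ n, φ =ᶠ[𝓝 p] e n) ∧ ∀ q, ∃ n, ψ =ᶠ[𝓝 q] (e n).symm := by
  obtain ⟨φ, hφ⟩ := exists_eventuallyEq_of_locallyFinite hM (f := fun n => e n) he
  obtain ⟨ψ, hψ⟩ := LocallyFinite.exists_forall_eventually_atTop_eventuallyEq
    (f := fun n => (e n).symm) he_symm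
  have hψM (q : Y) : ψ q ∈ M := by
    by_contra hq
    obtain ⟨n, hne, hn⟩ := ((hescape _ hq q).and_eventually (hψ q)).exists
    exact hne (by rw [← hn.eq_of_nhds, Equiv.apply_symm_apply])
  refine ⟨φ, ψ, fun q _ => hψM q, ⟨fun p hp => ?_, fun q _ => ?_⟩, fun p hp => (hφ p hp).exists,
    fun q => (hψ q).exists.imp fun _ h => h.symm⟩
  · obtain ⟨n, hn, hn'⟩ := ((hφ p hp).and (hψ (φ p))).exists
    rw [← hn'.eq_of_nhds, hn.eq_of_nhds, Equiv.symm_apply_apply]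
  · obtain ⟨n, hn, hn'⟩ := ((hφ _ (hψM q)).and (hψ q)).exists
    rw [hn.eq_of_nhds, ← hn'.eq_of_nhds, Equiv.apply_symm_apply]

end LocallyFinite

section SymplecticVectorSpace

variable {E : Type*} [NormedAddCommGroup E] [NormedSpace ℝ E] {Ω : LinearMap.BilinForm ℝ E}

theorem fderiv_apply_fderiv_symm_apply {F : Type*} [NormedAddCommGroup F] [NormedSpace ℝ F]
    {e : E ≃ F} (he : Differentiable ℝ e) (he' : Differentiable ℝ e.symm) (q v : F) :
    fderiv ℝ e (e.symm q) (fderiv ℝ e.symm q v) = v := by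
  rw [← ContinuousLinearMap.comp_apply, ← fderiv_comp q (he _) (he' _), e.self_comp_symm,
    fderiv_id]
  rfl

/-- The group of symplectomorphisms of `(E, Ω)` onto itself. -/
def symplectomorphismGroup (Ω : LinearMap.BilinForm ℝ E) : Subgroup (Equiv.Perm E) where
  carrier := {e | ContDiff ℝ ∞ e ∧ ContDiff ℝ ∞ e.symm ∧
    ∀ p u v, Ω (fderiv ℝ e p u) (fderiv ℝ e p v) = Ω u v}
  one_mem' := ⟨contDiff_id, contDiff_id, fun p u v => by simp⟩
  mul_mem' := by
    rintro e f ⟨he, he', heΩ⟩ ⟨hf, hf', hfΩ⟩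
    refine ⟨he.comp hf, hf'.comp he', fun p u v => ?_⟩
    rw [Equiv.Perm.coe_mul, fderiv_comp p (he.differentiable (by simp) _)
      (hf.differentiable (by simp) _)]
    simp only [ContinuousLinearMap.comp_apply, heΩ, hfΩ]
  inv_mem' := by
    rintro e ⟨he, he', heΩ⟩
    refine ⟨he', he, fun p u v => ?_⟩
    rw [← heΩ (e.symm p)]
    simp only [Equiv.Perm.inv_def, fderiv_apply_fderiv_symm_apply (he.differentiable (by simp))
      (he'.differentiable (by simp))]

theorem exists_mem_symplectomorphismGroup_add_eq_of_sub [CompleteSpace E] {X : E → E} {K : ℝ≥0}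
    (hX : LipschitzWith K X) (hK : K < 1) (hs : ContDiff ℝ ∞ X)
    (hskew : ∀ p u v, Ω (fderiv ℝ X p u) v = -Ω u (fderiv ℝ X p v)) :
    ∃ e ∈ symplectomorphismGroup Ω, ∀ p, e (p - X p) = p + X p := by
  obtain ⟨A, hA⟩ := exists_homeomorph_id_add hX.neg hK
  obtain ⟨B, hB⟩ := exists_homeomorph_id_add hX hK
  have hAs : ContDiff ℝ ∞ A := funext hA ▸ contDiff_id.add hs.neg
  have hBs : ContDiff ℝ ∞ B := funext hB ▸ contDiff_id.add hs
  have hAs' := contDiff_symm_of_eq_id_add hX.neg hK (by simp) hs.neg A hA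
  have hBs' := contDiff_symm_of_eq_id_add hX hK (by simp) hs B hB
  have hXd : Differentiable ℝ X := hs.differentiable (by simp)
  have hAd (p u : E) : fderiv ℝ A p u = u - fderiv ℝ X p u := by
    rw [funext hA, fderiv_fun_add differentiableAt_fun_id (hXd p).neg, fderiv_fun_id,
      fderiv_neg, sub_eq_add_neg]
    rfl
  have hBd (p u : E) : fderiv ℝ B p u = u + fderiv ℝ X p u := by
    rw [funext hB, fderiv_fun_add differentiableAt_fun_id (hXd p), fderiv_fun_id]
    rfl
  -- By skewness of `DX p`, both sides equal `Ω u v + Ω (DX p u) (DX p v)`.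
  have hcayley (p u v : E) :
      Ω (fderiv ℝ B p u) (fderiv ℝ B p v) = Ω (fderiv ℝ A p u) (fderiv ℝ A p v) := by
    simp only [hAd, hBd, map_add, map_sub, LinearMap.add_apply, LinearMap.sub_apply, hskew]
    ring
  refine ⟨A.symm.toEquiv.trans B.toEquiv, ⟨hBs.comp hAs', hAs.comp hBs', fun q u v => ?_⟩,
    fun p => ?_⟩
  · have hAinv := fderiv_apply_fderiv_symm_apply (e := A.toEquiv) (hAs.differentiable (by simp))
      (hAs'.differentiable (by simp)) q
    have hcomp (w : E) :
        fderiv ℝ (B ∘ A.symm) q w = fderiv ℝ B (A.symm q) (fderiv ℝ A.symm q w) := by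
      rw [fderiv_comp q (hBs.differentiable (by simp) _) (hAs'.differentiable (by simp) _),
        ContinuousLinearMap.comp_apply]
    calc Ω (fderiv ℝ (B ∘ A.symm) q u) (fderiv ℝ (B ∘ A.symm) q v)
        = Ω (fderiv ℝ A (A.symm q) (fderiv ℝ A.symm q u))
            (fderiv ℝ A (A.symm q) (fderiv ℝ A.symm q v)) := by rw [hcomp, hcomp, hcayley]
      _ = Ω u v := congr_arg₂ (fun x y => Ω x y) (hAinv u) (hAinv v)
  · have hAp : A p = p - X p := by rw [hA, Pi.neg_apply, sub_eq_add_neg]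
    change B (A.symm (p - X p)) = p + X p
    rw [← hAp, A.symm_apply_apply, hB]

variable [FiniteDimensional ℝ E]

/-- The isomorphism from covectors to vectors given by the nondegenerate form `Ω`: it sends `α` to
the vector `u` with `Ω u · = α`. -/
noncomputable def sharp (hΩ : Ω.Nondegenerate) : (E →L[ℝ] ℝ) →L[ℝ] E :=
  LinearMap.toContinuousLinearMap ((Ω.toDual hΩ).symm.toLinearMap ∘ₗ ContinuousLinearMap.coeLM ℝ)

theorem apply_sharp (hΩ : Ω.Nondegenerate) (α : E →L[ℝ] ℝ) (v : E) : Ω (sharp hΩ α) v = α v :=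
  LinearMap.BilinForm.apply_toDual_symm_apply (hB := hΩ) (α : E →ₗ[ℝ] ℝ) v

theorem sharp_eq_iff (hΩ : Ω.Nondegenerate) {α : E →L[ℝ] ℝ} {u : E} :
    sharp hΩ α = u ↔ ∀ v, Ω u v = α v := by
  refine ⟨?_, fun h => ?_⟩
  · rintro rfl v
    exact apply_sharp hΩ α v
  · refine LinearMap.ker_eq_bot.1 hΩ.ker_eq_bot (LinearMap.ext fun v => ?_)
    rw [apply_sharp, h]

/-- The Hamiltonian vector field `X_H` of `H`, with the sign convention `Ω (X_H) · = dH`. -/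
noncomputable def hamiltonianField (hΩ : Ω.Nondegenerate) (H : E → ℝ) (p : E) : E :=
  sharp hΩ (fderiv ℝ H p)

variable {hΩ : Ω.Nondegenerate} {H : E → ℝ}

theorem contDiff_hamiltonianField (hH : ContDiff ℝ ∞ H) : ContDiff ℝ ∞ (hamiltonianField hΩ H) :=
  (sharp hΩ).contDiff.comp (hH.fderiv_right (by simp))

theorem hamiltonianField_const_smul (c : ℝ) :
    hamiltonianField hΩ (c • H) = c • hamiltonianField hΩ H := by
  ext1 p
  simp only [hamiltonianField, fderiv_const_smul_field, Pi.smul_apply, map_smul]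

theorem hamiltonianField_mul {f g : E → ℝ} {p : E} (hf : DifferentiableAt ℝ f p)
    (hg : DifferentiableAt ℝ g p) : hamiltonianField hΩ (f * g) p =
      f p • hamiltonianField hΩ g p + g p • hamiltonianField hΩ f p := by
  simp only [hamiltonianField, fderiv_mul hf hg, map_add, map_smul]

theorem apply_fderiv_hamiltonianField (halt : Ω.IsAlt) (hH : ContDiff ℝ 2 H) (p u v : E) :
    Ω (fderiv ℝ (hamiltonianField hΩ H) p u) v =
      -Ω u (fderiv ℝ (hamiltonianField hΩ H) p v) := by
  have hd : DifferentiableAt ℝ (fderiv ℝ H) p :=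
    (hH.fderiv_right (m := 1) one_add_one_eq_two.le).differentiable one_ne_zero p
  have hfderiv : fderiv ℝ (hamiltonianField hΩ H) p = (sharp hΩ).comp (fderiv ℝ (fderiv ℝ H) p) :=
    ((sharp hΩ).hasFDerivAt.comp p hd.hasFDerivAt).fderiv
  have hsymm : IsSymmSndFDerivAt ℝ H p  :=
    hH.contDiffAt.isSymmSndFDerivAt minSmoothness_of_isRCLikeNormedField.le
  rw [LinearMap.BilinForm.IsAlt.neg_eq halt, hfderiv, ContinuousLinearMap.comp_apply, apply_sharp,
    ContinuousLinearMap.comp_apply, apply_sharp]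
  exact hsymm.eq u v

theorem exists_lipschitzWith_hamiltonianField_const_smul (hH : ContDiff ℝ ∞ H)
    (hc : HasCompactSupport H) :
    ∃ c : ℝ, 0 < c ∧ ∃ K < 1, LipschitzWith K (hamiltonianField hΩ (c • H)) := by
  have hcompact : HasCompactSupport (hamiltonianField hΩ H) :=
    (hc.fderiv ℝ).comp_left (map_zero (sharp hΩ))
  obtain ⟨C, hC⟩ :=
    (contDiff_hamiltonianField hH).lipschitzWith_of_hasCompactSupport hcompact (by simp)
  have hC1 : 0 < C + 1 := by positivity
  refine ⟨((C + 1)⁻¹ : ℝ≥0), by positivity, (C + 1)⁻¹ * C, ?_, ?_⟩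
  · rw [inv_mul_lt_iff₀ hC1, mul_one]
    exact lt_add_one C
  · rw [hamiltonianField_const_smul]
    refine LipschitzWith.of_dist_le_mul fun x y => ?_
    simpa only [Pi.smul_apply, dist_smul₀, Real.norm_eq_abs, NNReal.abs_eq, NNReal.coe_mul,
      mul_assoc] using mul_le_mul_of_nonneg_left (hC.dist_le_mul x y) (C + 1)⁻¹.coe_nonneg

end SymplecticVectorSpace

section PhaseSpace

variable {n : ℕ}

/-- The standard symplectic form `ω₀` as a bilinear form on the vector space `ℝ²ⁿ`. -/
noncomputable def omega0Form (n : ℕ) : LinearMap.BilinForm ℝ (PhaseSpace n) :=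
  LinearMap.mk₂ ℝ omega0
    (fun u v w => by
      simp only [omega0, PiLp.add_apply, ← Finset.sum_add_distrib]
      exact Finset.sum_congr rfl fun i _ => by ring)
    (fun c u v => by
      simp only [omega0, PiLp.smul_apply, smul_eq_mul, Finset.mul_sum]
      exact Finset.sum_congr rfl fun i _ => by ring)
    (fun u v w => by
      simp only [omega0, PiLp.add_apply, ← Finset.sum_add_distrib]
      exact Finset.sum_congr rfl fun i _ => by ring)
    (fun c u v => by
      simp only [omega0, PiLp.smul_apply, smul_eq_mul, Finset.mul_sum]
      exact Finset.sum_congr rfl fun i _ => by ring)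

theorem omega0Form_apply (u v : PhaseSpace n) : omega0Form n u v = omega0 u v := rfl

theorem omega0_single_zero_left (i : Fin n) (v : PhaseSpace n) :
    omega0 (EuclideanSpace.single (i, 0) 1) v = v (i, 1) := by
  simp [omega0]

theorem omega0_single_one_left (i : Fin n) (v : PhaseSpace n) :
    omega0 (EuclideanSpace.single (i, 1) 1) v = -v (i, 0) := by
  simp [omega0]

theorem isAlt_omega0Form : (omega0Form n).IsAlt := fun u =>
  (Finset.sum_eq_zero fun i _ => by ring : omega0 u u = 0)

theorem nondegenerate_omega0Form : (omega0Form n).Nondegenerate := by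
  refine (isAlt_omega0Form.isRefl.nondegenerate_iff_separatingRight).2 fun v hv => ?_
  ext ⟨i, j⟩
  fin_cases j
  · exact neg_eq_zero.1 ((omega0_single_one_left i v).symm.trans (hv _))
  · exact (omega0_single_zero_left i v).symm.trans (hv _)

theorem hamiltonianField_coord_one (i : Fin n) (p : PhaseSpace n) :
    hamiltonianField nondegenerate_omega0Form (fun q => q (i, 1)) p =
      EuclideanSpace.single (i, 0) 1 := by
  refine (sharp_eq_iff _).2 fun v => ?_
  rw [omega0Form_apply, omega0_single_zero_left]
  exact (congrArg (· v)
    (EuclideanSpace.proj (i, 1) : PhaseSpace n →L[ℝ] ℝ).hasFDerivAt.fderiv).symm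

theorem isSymplectomorphism_of_eventuallyEq {φ ψ : PhaseSpace n → PhaseSpace n}
    {A B : Set (PhaseSpace n)} (hA : IsOpen A) (hB : IsOpen B)
    (hφ : ∀ p ∈ A, ∃ e ∈ symplectomorphismGroup (omega0Form n), φ =ᶠ[𝓝 p] e)
    (hψ : ∀ q ∈ B, ∃ e ∈ symplectomorphismGroup (omega0Form n), ψ =ᶠ[𝓝 q] e)
    (hφAB : MapsTo φ A B) (hψBA : MapsTo ψ B A) (hinv : InvOn ψ φ A B) :
    IsSymplectomorphism φ A B := by
  have hsmooth {φ : PhaseSpace n → PhaseSpace n} {A : Set (PhaseSpace n)}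
      (hφ : ∀ p ∈ A, ∃ e ∈ symplectomorphismGroup (omega0Form n), φ =ᶠ[𝓝 p] e) :
      ContDiffOn ℝ ∞ φ A := fun p hp => by
    obtain ⟨e, he, hev⟩ := hφ p hp
    exact (he.1.contDiffAt.congr_of_eventuallyEq hev).contDiffWithinAt
  refine ⟨hA, hB, hsmooth hφ, ⟨ψ, hφAB, hψBA, hinv, hsmooth hψ⟩, fun p hp u v => ?_⟩
  obtain ⟨e, he, hev⟩ := hφ p hp
  rw [hev.fderiv_eq]
  exact he.2.2 p u v

end PhaseSpace

section Axis

variable {m : ℕ} {U : Set (PhaseSpace (m + 1))}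

theorem isometry_gamma0 : Isometry (gamma0 m) :=
  Isometry.of_dist_eq fun _ _ => PiLp.dist_single_same 2 _ _ _ _

theorem gamma0_add (s t : ℝ) : gamma0 m (s + t) = gamma0 m s + gamma0 m t :=
  PiLp.single_add 2 _

theorem gamma0_sub (s t : ℝ) : gamma0 m (s - t) = gamma0 m s - gamma0 m t :=
  PiLp.single_sub 2 _

theorem gamma0_zero : gamma0 m 0 = 0 :=
  (PiLp.single_eq_zero_iff 2 _).2 rfl

theorem smul_gamma0 (c s : ℝ) : c • gamma0 m s = gamma0 m (c * s) := by
  ext k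
  simp [gamma0, PiLp.single_apply]

theorem gamma0_apply_last_zero (s : ℝ) : gamma0 m s (Fin.last m, 0) = s := by
  simp [gamma0]

theorem gamma0_apply_last_one (s : ℝ) : gamma0 m s (Fin.last m, 1) = 0 := by
  simp [gamma0]

/-- The symplectomorphisms of `ℝ²ⁿ` supported in `U` that preserve the `xₙ`-axis and its
orientation, each paired with the homeomorphism of `ℝ` it induces on the axis. -/
def axisSymplectic (U : Set (PhaseSpace (m + 1))) :
    Submonoid (Equiv.Perm (PhaseSpace (m + 1)) × (ℝ ≃o ℝ)) where
  carrier := {a | a.1 ∈ symplectomorphismGroup (omega0Form (m + 1)) ∧ (∀ p ∉ U, a.1 p = p) ∧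
    ∀ s, a.1 (gamma0 m s) = gamma0 m (a.2 s)}
  one_mem' := ⟨one_mem _, fun _ _ => rfl, fun _ => rfl⟩
  mul_mem' := by
    rintro ⟨d, f⟩ ⟨e, g⟩ ⟨hd, hdU, hdγ⟩ ⟨he, heU, heγ⟩
    refine ⟨mul_mem hd he, fun p hp => ?_, fun s => ?_⟩
    · exact (congrArg d (heU p hp)).trans (hdU p hp)
    · exact (congrArg d (heγ s)).trans (hdγ (g s))

theorem axisSymplectic_mono : Monotone (axisSymplectic (m := m)) :=
  fun _ _ hUV _ ha => ⟨ha.1, fun p hp => ha.2.1 p fun h => hp (hUV h), ha.2.2⟩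

theorem exists_mem_axisSymplectic_eq_add_of_eq_sub
    {X : PhaseSpace (m + 1) → PhaseSpace (m + 1)} {f : ℝ → ℝ} {K : ℝ≥0}
    (hX : LipschitzWith K X) (hK : K < 1) (hs : ContDiff ℝ ∞ X)
    (hskew : ∀ p u v, omega0Form _ (fderiv ℝ X p u) v = -omega0Form _ u (fderiv ℝ X p v))
    (hXU : ∀ p ∉ U, X p = 0) (hXγ : ∀ s, X (gamma0 m s) = gamma0 m (f s)) :
    ∃ a ∈ axisSymplectic U, ∀ s, ∃ u, s = u - f u ∧ a.2 s = u + f u := by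
  have hf : LipschitzWith K f := fun s t => by
    simpa only [hXγ, isometry_gamma0.edist_eq] using hX (gamma0 m s) (gamma0 m t)
  obtain ⟨e, he, heX⟩ := exists_mem_symplectomorphismGroup_add_eq_of_sub hX hK hs hskew
  obtain ⟨g, hg⟩ := exists_orderIso_eq_add_of_eq_sub hf hK
  refine ⟨(e, g), ⟨he, fun p hp => ?_, fun s => ?_⟩, hg⟩
  · simpa only [hXU p hp, sub_zero, add_zero] using heX p
  · obtain ⟨u, hsu, hgu⟩ := hg s
    simpa only [hXγ, ← gamma0_sub, ← gamma0_add, ← hsu, ← hgu] using heX (gamma0 m u)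

theorem hamiltonianField_mul_coord_last_one {χ : PhaseSpace (m + 1) → ℝ}
    {p : PhaseSpace (m + 1)} (hχ : DifferentiableAt ℝ χ p) :
    hamiltonianField nondegenerate_omega0Form (χ * fun q => q (Fin.last m, 1)) p =
      gamma0 m (χ p) +
        p (Fin.last m, 1) • hamiltonianField nondegenerate_omega0Form χ p := by
  rw [hamiltonianField_mul hχ (by fun_prop), hamiltonianField_coord_one]
  congr 1
  exact (smul_gamma0 (χ p) 1).trans (by rw [mul_one])

theorem exists_mem_axisSymplectic_forall_lt (hU : IsOpen U) (hUb : Bornology.IsBounded U) :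
    ∃ a ∈ axisSymplectic U, ∀ s, gamma0 m s ∈ U → s < a.2 s := by
  obtain ⟨χ, hχU, hχ, hχ01⟩ := hU.exists_contDiff_support_eq (n := ⊤)
  have hχ0 (p) : 0 ≤ χ p := (hχ01 (mem_range_self p)).1
  set H : PhaseSpace (m + 1) → ℝ := χ * fun q => q (Fin.last m, 1)
  have hH : ContDiff ℝ ∞ H := hχ.mul (by fun_prop)
  have hHc : HasCompactSupport H := HasCompactSupport.mul_right <|
    hUb.isCompact_closure.of_isClosed_subset isClosed_closure (closure_mono hχU.le)
  obtain ⟨c, hc, K, hK, hX⟩ :=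
    exists_lipschitzWith_hamiltonianField_const_smul (hΩ := nondegenerate_omega0Form) hH hHc
  have hcH : ContDiff ℝ ∞ (c • H) := hH.const_smul c
  have hfield (p) : hamiltonianField nondegenerate_omega0Form (c • H) p = c • (gamma0 m (χ p) +
      p (Fin.last m, 1) • hamiltonianField nondegenerate_omega0Form χ p) := by
    rw [hamiltonianField_const_smul, Pi.smul_apply,
      hamiltonianField_mul_coord_last_one (hχ.differentiable (by simp) p)]
  have hfieldU (p) (hp : p ∉ U) : hamiltonianField nondegenerate_omega0Form (c • H) p = 0 := by
    have hp0 : χ p = 0 := Function.notMem_support.1 (hχU ▸ hp)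
    have hmin : IsLocalMin χ p := .of_forall fun q => hp0.trans_le (hχ0 q)
    rw [hfield, hp0, gamma0_zero, hamiltonianField, hmin.fderiv_eq_zero, map_zero, smul_zero,
      add_zero, smul_zero]
  have hfieldγ (s) : hamiltonianField nondegenerate_omega0Form (c • H) (gamma0 m s) =
      gamma0 m (c * χ (gamma0 m s)) := by
    rw [hfield, gamma0_apply_last_one, zero_smul, add_zero, smul_gamma0]
  obtain ⟨a, ha, haf⟩ := exists_mem_axisSymplectic_eq_add_of_eq_sub hX hK
    (contDiff_hamiltonianField hcH)
    (apply_fderiv_hamiltonianField isAlt_omega0Form (contDiff_infty.1 hcH 2))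
    hfieldU hfieldγ
  refine ⟨a, ha, fun s hs => ?_⟩
  obtain ⟨u, hsu, hau⟩ := haf s
  have hu : χ (gamma0 m u) ≠ 0 := fun hu => by
    rw [hu, mul_zero, sub_zero] at hsu
    rw [← hχU, hsu] at hs
    exact hs hu
  linarith [mul_pos hc ((hχ0 _).lt_of_ne' hu)]

theorem exists_mem_axisSymplectic_lt (hU : IsOpen U) {a b : ℝ}
    (hab : ∀ s ∈ Icc a b, gamma0 m s ∈ U) : ∃ d ∈ axisSymplectic U, b < d.2 a := by
  obtain ⟨R, hR⟩ :=
    (isCompact_Icc.image (isometry_gamma0 (m := m)).continuous).isBounded.subset_ball 0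
  obtain ⟨d, hd, hlt⟩ := exists_mem_axisSymplectic_forall_lt (hU.inter Metric.isOpen_ball)
    (Metric.isBounded_ball.subset inter_subset_right)
  obtain ⟨N, hN⟩ := exists_lt_iterate d.2.continuous
    fun s hs => hlt s ⟨hab s hs, hR (mem_image_of_mem _ hs)⟩
  refine ⟨d ^ N, pow_mem (axisSymplectic_mono inter_subset_left hd) N, ?_⟩
  have hpow : ⇑(d.2 ^ N) = d.2^[N] := hom_coe_pow (fun g : ℝ ≃o ℝ => ⇑g) rfl (fun _ _ => rfl) d.2 N
  rwa [Prod.pow_snd, hpow]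

end Axis

section Excision

variable {m : ℕ} {O V : Set (PhaseSpace (m + 1))}

theorem isClosed_rayL1 : IsClosed (rayL1 m) :=
  isometry_gamma0.isClosedEmbedding.isClosedMap _ isClosed_Ici

theorem isOpen_spaceM1 : IsOpen (spaceM1 m) := isClosed_rayL1.isOpen_compl

theorem isOpen_regionW (ε : ℝ) : IsOpen (regionW ε) := by
  have hx : IsOpen {p : EuclideanSpace ℝ (Fin 2) | p 0 > √2 * ε / 2} :=
    isOpen_lt (by fun_prop) (by fun_prop)
  have hxy : IsOpen {p : EuclideanSpace ℝ (Fin 2) | p 0 * |p 1| < ε ^ 2 / 2} :=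
    isOpen_lt (by fun_prop) (by fun_prop)
  exact Metric.isOpen_ball.union (hx.inter hxy)

theorem isOpen_rayNbhd (ε : ℝ) : IsOpen (rayNbhd m ε) := by
  have hinit : Continuous (initCoords (m := m)) := by unfold initCoords; fun_prop
  have hlast : Continuous (lastCoords (m := m)) := by unfold lastCoords; fun_prop
  exact (Metric.isOpen_ball.preimage hinit).inter ((isOpen_regionW ε).preimage hlast)

theorem initCoords_gamma0 (s : ℝ) : initCoords (gamma0 m s) = 0 := by
  ext ⟨i, j⟩
  simp [initCoords, gamma0]

theorem lastCoords_gamma0 (s : ℝ) : lastCoords (gamma0 m s) = EuclideanSpace.single 0 s := by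
  ext j
  fin_cases j <;> simp [lastCoords, gamma0]

theorem single_zero_mem_regionW {ε s : ℝ} (hε : 0 < ε) (hs : 0 ≤ s) :
    EuclideanSpace.single 0 s ∈ regionW ε := by
  rcases lt_or_ge s ε with hsε | hsε
  · left
    simpa [abs_of_nonneg hs] using hsε
  · right
    have hsqrt : √2 < 2 := by rw [Real.sqrt_lt' two_pos]; norm_num
    have hx : √2 * ε / 2 < s := by nlinarith
    have hy : 0 < ε ^ 2 / 2 := by positivity
    simpa using And.intro hx hy

theorem rayL1_subset_rayNbhd {ε : ℝ} (hε : 0 < ε) : rayL1 m ⊆ rayNbhd m ε := by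
  rintro _ ⟨s, hs, rfl⟩
  rw [rayNbhd, mem_ofPred_eq, initCoords_gamma0, lastCoords_gamma0]
  exact ⟨Metric.mem_ball_self hε, single_zero_mem_regionW hε hs⟩

/-- The correction `d` is made before `a`, close to the ray but where `a` takes values with large
`xₙ`; hence neither `a` away from the ray nor its inverse at small `xₙ` is affected. -/
theorem exists_mul_mem_axisSymplectic (hV : IsOpen V) (hVO : V ⊆ O) (hLV : rayL1 m ⊆ V)
    {a : Equiv.Perm (PhaseSpace (m + 1)) × (ℝ ≃o ℝ)} (ha : a ∈ axisSymplectic O) :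
    ∃ d, a * d ∈ axisSymplectic O ∧ a.2 0 + 1 ≤ (a * d).2 0 ∧
      (∀ p ∉ V, (a * d).1 p = a.1 p) ∧
      ∀ q, q (Fin.last m, 0) ≤ a.2 0 - 1 → (a * d).1.symm q = a.1.symm q := by
  have hU : IsOpen (V ∩ {p | a.2 0 - 1 < a.1 p (Fin.last m, 0)}) := by
    have hcont : Continuous a.1 := ha.1.1.continuous
    exact hV.inter (isOpen_lt (by fun_prop) (by fun_prop))
  obtain ⟨d, hd, hlt⟩ := exists_mem_axisSymplectic_lt hU (a := 0) (b := a.2.symm (a.2 0 + 1))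
    fun s hs => ⟨hLV (mem_image_of_mem _ hs.1), by
      rw [mem_ofPred_eq, ha.2.2, gamma0_apply_last_zero]
      linarith [a.2.monotone hs.1]⟩
  refine ⟨d, mul_mem ha (axisSymplectic_mono (inter_subset_left.trans hVO) hd), ?_,
    fun p hp => ?_, fun q hq => ?_⟩
  · exact a.2.symm_apply_le.1 hlt.le
  · exact congrArg a.1 (hd.2.1 p fun h => hp h.1)
  · refine d.1.symm_apply_eq.2 (hd.2.1 _ fun h => ?_).symm
    have hlt : a.2 0 - 1 < a.1 (a.1.symm q) (Fin.last m, 0) := h.2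
    rw [Equiv.apply_symm_apply] at hlt
    exact hlt.not_ge hq

theorem exists_seq_mem_axisSymplectic {V : ℕ → Set (PhaseSpace (m + 1))} (hV : ∀ j, IsOpen (V j))
    (hVO : ∀ j, V j ⊆ O) (hLV : ∀ j, rayL1 m ⊆ V j) :
    ∃ a : ℕ → Equiv.Perm (PhaseSpace (m + 1)) × (ℝ ≃o ℝ), ∀ j, a j ∈ axisSymplectic O ∧
      j ≤ (a j).2 0 ∧ (∀ p ∉ V j, (a (j + 1)).1 p = (a j).1 p) ∧
      ∀ q, q (Fin.last m, 0) ≤ (j : ℝ) - 1 → (a (j + 1)).1.symm q = (a j).1.symm q := by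
  choose d hmem hpush hV' hsymm using fun (j : ℕ) (a : axisSymplectic O) =>
    exists_mul_mem_axisSymplectic (hV j) (hVO j) (hLV j) a.2
  let a (j : ℕ) : axisSymplectic O := Nat.rec 1 (fun j a => ⟨a * d j a, hmem j a⟩) j
  have hle (j : ℕ) : j ≤ (a j).1.2 0 := by
    induction j with
    | zero => exact Nat.cast_zero.le
    | succ j ih =>
      rw [Nat.cast_succ]
      exact (add_le_add_left ih 1).trans (hpush j (a j))
  exact ⟨fun j => (a j).1, fun j => ⟨(a j).2, hle j, hV' j (a j),
    fun q hq => hsymm j (a j) q (hq.trans (sub_le_sub_right (hle j) 1))⟩⟩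

theorem theorem1p1_general (hO : IsOpen O) (hLO : rayL1 m ⊆ O) :
    ∃ φ : PhaseSpace (m + 1) → PhaseSpace (m + 1), IsSymplectomorphism φ (spaceM1 m) univ ∧
      ∀ p ∈ spaceM1 m, p ∉ O → φ p = p := by
  obtain ⟨a, ha⟩ := exists_seq_mem_axisSymplectic
    (V := fun j => O ∩ Metric.thickening (1 / ((j : ℝ) + 1)) (rayL1 m))
    (fun j => hO.inter Metric.isOpen_thickening) (fun j => inter_subset_left)
    (fun j => subset_inter hLO (Metric.self_subset_thickening (by positivity) _))
  choose hmem hle hV hsymm using ha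
  have hfin : LocallyFinite fun j => {p : spaceM1 m | (a (j + 1)).1 p ≠ (a j).1 p} :=
    (locallyFinite_thickening isClosed_rayL1 tendsto_one_div_add_atTop_nhds_zero_nat).subset
      fun j p hp => by_contra fun h => hp (hV j p fun h' => h h'.2)
  have hlim : Tendsto (fun j : ℕ => (j : ℝ) - 1) atTop atTop :=
    tendsto_atTop_add_const_right _ (-1) tendsto_natCast_atTop_atTop
  have hxn : Continuous fun q : PhaseSpace (m + 1) => q (Fin.last m, 0) := by fun_prop
  have hfin_symm : LocallyFinite fun j => {q | (a (j + 1)).1.symm q ≠ (a j).1.symm q} :=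
    (locallyFinite_setOf_lt_of_tendsto_atTop hxn hlim).subset
      fun j q hq => not_le.1 fun h => hq (hsymm j q h)
  have hescape (p) (hp : p ∉ spaceM1 m) (q) : ∃ᶠ j in atTop, (a j).1 p ≠ q := by
    obtain ⟨s, hs, rfl⟩ := notMem_compl_iff.1 hp
    refine ((tendsto_natCast_atTop_atTop.eventually_gt_atTop (q (Fin.last m, 0))).mono
      fun j hj hq => ?_).frequently
    rw [← hq, (hmem j).2.2, gamma0_apply_last_zero] at hj
    exact hj.not_ge ((hle j).trans ((a j).2.monotone hs))
  obtain ⟨φ, ψ, hψM, hinv, hφ, hψ⟩ :=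
    exists_invOn_of_locallyFinite isOpen_spaceM1 hfin hfin_symm hescape
  refine ⟨φ, isSymplectomorphism_of_eventuallyEq isOpen_spaceM1 isOpen_univ
    (fun p hp => (hφ p hp).imp' _ fun j h => ⟨(hmem j).1, h⟩)
    (fun q _ => (hψ q).imp' _ fun j h => ⟨inv_mem (hmem j).1, h⟩) (mapsTo_univ _ _) hψM hinv,
    fun p hp hpO => ?_⟩
  obtain ⟨j, hj⟩ := hφ p hp
  exact hj.eq_of_nhds.trans ((hmem j).2.1 p hpO)

end Excision

/-- Here `n = m + 1` ranges over all integers `n ≥ 1`. -/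
theorem theorem1p1 (m : ℕ) :
    IsStandard (spaceM1 m) ∧
    ∀ ε : ℝ, 0 < ε →
      ∃ φ : PhaseSpace (m + 1) → PhaseSpace (m + 1),
        IsSymplectomorphism φ (spaceM1 m) Set.univ ∧
        ∀ p ∈ spaceM1 m, p ∉ rayNbhd m ε → φ p = p := by
  have key (ε : ℝ) (hε : 0 < ε) :=
    theorem1p1_general (isOpen_rayNbhd (m := m) ε) (rayL1_subset_rayNbhd hε)
  exact ⟨⟨isOpen_spaceM1, (key 1 one_pos).imp fun _ h => h.1⟩, key⟩
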